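/- Let $X$ be a topological space. A family $\mathcal N$ of subsets of $X$ is a $\mathrm{cs}^*$-network at a point $x\in X$ if for every neighborhood $U$ of $x$ and every sequence $(x_n)$ in $X$ convergent to $x$ there is $N\in\mathcal N$ with $N\subset U$ such that $x_n\in N$ for infinitely many $n$. The $\mathrm{cs}^*$-character $\mathrm{cs}^*_\chi(X,x)$ of $X$ at $x$ is the smallest cardinality of a $\mathrm{cs}^*$-network at $x$, and the $\mathrm{cs}^*$-character of a nonempty space $X$ is $\mathrm{cs}^*_\chi(X)=\sup_{x\in X}\mathrm{cs}^*_\chi(X,x)$. The space $X$ carries the inductive topology with respect to a cover $\mathcal C$ of $X$ if a set $F\subset X$ is closed in $X$ if and only if $F\cap C$ is closed in $C$ for every $C\in\mathcal C$. A topological group is an $\mathcal M_\omega$-group (resp. an $\mathcal{MK}_\omega$-group) if its underlying space carries the inductive topology with respect to a countable cover by closed metrizable (resp. closed compact metrizable) subspaces. **Theorem 1.** Let $G$ be a topological group whose underlying space is $T_1$ and sequential (every sequentially closed subset is closed), and suppose that $\mathrm{cs}^*_\chi(G)\le\aleph_0$. Then $G$ is an $\mathcal M_\omega$-group. More precisely,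 either $G$ is metrizable, or $G$ has an open subgroup $H$ that is an $\mathcal{MK}_\omega$-group and $G$ is homeomorphic to $H\times D$ for some discrete space $D$. -/

import Mathlib

open Set Filter Topology

universe u

/-- A family `N` of subsets of `X` is a `cs*`-network at `x` if for every neighborhood `U` of `x`
and every sequence convergent to `x` some element of `N` lies in `U` and contains infinitely many
members of the sequence (i.e. `s n ∈ A` for infinitely many indices `n`). -/
def IsCsStarNetworkAt {X : Type u} [TopologicalSpace X] (N : Set (Set X)) (x : X) : Prop :=
  ∀ U ∈ 𝓝 x, ∀ s : ℕ → X, Tendsto s atTop (𝓝 x) →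
    ∃ A ∈ N, A ⊆ U ∧ {n : ℕ | s n ∈ A}.Infinite

/-- The `cs*`-character of `X` at `x`: the smallest cardinality of a `cs*`-network at `x`. -/
noncomputable def csStarCharacterAt (X : Type u) [TopologicalSpace X] (x : X) : Cardinal.{u} :=
  sInf {κ : Cardinal.{u} | ∃ N : Set (Set X), IsCsStarNetworkAt N x ∧ Cardinal.mk N = κ}

open Classical in
/-- The `cs*`-character of `X`: the supremum of the `cs*`-characters at the points of `X`,
with the value `1` for the empty space. -/
noncomputable def csStarCharacter (X : Type u) [TopologicalSpace X] : Cardinal.{u} :=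
  if IsEmpty X then 1 else ⨆ x : X, csStarCharacterAt X x

/-- `X` carries the inductive topology with respect to the cover `C`: the family `C` covers `X`,
and a set is closed in `X` iff its trace on every `A ∈ C` is closed in `A` (equivalently, the same
with "open"; this is `Topology.IsCoherentWith`). -/
def HasInductiveTopology (X : Type u) [TopologicalSpace X] (C : Set (Set X)) : Prop :=
  ⋃₀ C = univ ∧ IsCoherentWith C

/-- `X` carries the inductive topology with respect to a countable cover by closed metrizable
subspaces. -/
def IsMOmegaSpace (X : Type u) [TopologicalSpace X] : Prop :=
  ∃ C : Set (Set X), C.Countable ∧ HasInductiveTopology X C ∧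
    ∀ A ∈ C, IsClosed A ∧ TopologicalSpace.MetrizableSpace A

/-- `X` carries the inductive topology with respect to a countable cover by closed compact
metrizable subspaces. -/
def IsMKOmegaSpace (X : Type u) [TopologicalSpace X] : Prop :=
  ∃ C : Set (Set X), C.Countable ∧ HasInductiveTopology X C ∧
    ∀ A ∈ C, IsClosed A ∧ IsCompact A ∧ TopologicalSpace.MetrizableSpace A

/-- A topological group whose underlying space is an `M_ω`-space. -/
def IsMOmegaGroup (G : Type u) [TopologicalSpace G] [Group G] : Prop :=
  IsTopologicalGroup G ∧ IsMOmegaSpace G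

/-- A topological group whose underlying space is an `MK_ω`-space. -/
def IsMKOmegaGroup (G : Type u) [TopologicalSpace G] [Group G] : Prop :=
  IsTopologicalGroup G ∧ IsMKOmegaSpace G

/-!
A countable `cs*`-network at `1` can be replaced by a countable `cs`-network `M` of closed sets that
is stable under finite unions (`exists_countable_isCsNetworkAtOne`). There are two cases.

If every neighborhood of `1` contains a member of `M` that all sequences convergent to `1` eventually
enter, then `G` is weakly first countable, and a sequential group with this property is first
countable, hence metrizable (`HasBarriersAtOne.metrizableSpace`).

Otherwise `G` contains a closed Fréchet–Urysohn fan (`exists_isFan`): spokes convergent to `1`, such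
that no diagonal through infinitely many spokes converges. That the fan can be made closed rests on
the fact that the closure of a countable set has a countable network (`isNetworkOn_closure`), so that
`1` is a `G_δ`-point in it. Now the product of a fan with a metric fan that is not locally compact is
not sequential; multiplying the two inside the sequential group `G` shows that the finite
intersections of members of `M` which capture a given sequence convergent to `1` cannot all fail to
be sequentially compact (`IsFan.exists_isSeqCompact_sInter`). Hence countably many sequentially
compact sets capture all sequences convergent to `1`.

A sequentially compact set is separable (`IsSeqCompact.exists_countable_subset_closure`), so by the
network of its closure it is Lindelöf, compact and metrizable. The subgroup generated by the
capturing sets is the union of an increasing sequence of compact metrizable sets which capture all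
its convergent sequences. Therefore it is open and has the inductive topology with respect to these
sets (`exists_open_subgroup_of_isSeqCompact`, `hasInductiveTopology_of_seq`). Finally `G` is
homeomorphic to the product of an open subgroup with the discrete space of its cosets, and products
of the compact sets with that discrete space form the cover of `G`.
-/

open scoped Pointwise

/-! ### Subsequences of natural numbers -/

section Sequences

theorem exists_subseq_const_or_strictMono (k : ℕ → ℕ) :
    ∃ φ : ℕ → ℕ, StrictMono φ ∧ ((∃ c, ∀ l, k (φ l) = c) ∨ StrictMono (k ∘ φ)) := by
  by_cases h : Tendsto k atTop atTop
  · obtain ⟨φ, hφ, hk⟩ := strictMono_subseq_of_tendsto_atTop h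
    exact ⟨φ, hφ, Or.inr hk⟩
  · rw [tendsto_atTop] at h
    push Not at h
    obtain ⟨b, hb⟩ := h
    obtain ⟨c, hc⟩ : ∃ c, ∃ᶠ l in atTop, k l = c := by
      by_contra! h
      have h' := (eventually_all_finite (Set.finite_Iio b)).2 fun c _ => h c
      obtain ⟨l, hl, hl'⟩ := (hb.and_eventually h').exists
      exact hl' (k l) hl rfl
    obtain ⟨φ, hφ, h⟩ := extraction_of_frequently_atTop hc
    exact ⟨φ, hφ, Or.inl ⟨c, h⟩⟩

end Sequences

/-! ### Countable networks and metrizability of compact sets -/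

section Network

variable {X : Type*} [TopologicalSpace X]

/-- `P` is a network at the points of `Y`: every neighborhood in `X` of a point `y ∈ Y` contains a
member of `P` that contains `y`. The members of `P` need not be open, nor subsets of `Y`. -/
def IsNetworkOn (P : Set (Set X)) (Y : Set X) : Prop :=
  ∀ y ∈ Y, ∀ U ∈ 𝓝 y, ∃ A ∈ P, y ∈ A ∧ A ⊆ U

theorem IsNetworkOn.isLindelof {P : Set (Set X)} {Y : Set X} (hP : IsNetworkOn P Y)
    (hc : P.Countable) : IsLindelof Y := by
  refine isLindelof_of_countable_subcover fun {ι} U hUo hYU => ?_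
  have key : ∀ A : {A : Set X // A ∈ P ∧ ∃ i, A ⊆ U i}, ∃ i, A.1 ⊆ U i := fun A => A.2.2
  choose f hf using key
  have : Countable {A : Set X // A ∈ P ∧ ∃ i, A ⊆ U i} :=
    (hc.mono (fun A hA => hA.1) : {A : Set X | A ∈ P ∧ ∃ i, A ⊆ U i}.Countable).to_subtype
  refine ⟨range f, countable_range f, fun y hy => ?_⟩
  obtain ⟨i, hi⟩ := mem_iUnion.1 (hYU hy)
  obtain ⟨A, hA, hyA, hAU⟩ := hP y hy (U i) ((hUo i).mem_nhds hi)
  exact mem_biUnion (mem_range_self ⟨A, hA, i, hAU⟩) (hf ⟨A, hA, i, hAU⟩ hyA)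

/-- A compact topology has no strictly coarser Hausdorff topology, so it is generated by any family
of open sets that separates points. -/
theorem secondCountableTopology_of_separating [i : CompactSpace X] {B : Set (Set X)}
    (hB : B.Countable) (ho : ∀ U ∈ B, IsOpen U)
    (hs : ∀ x y, x ≠ y → ∃ U ∈ B, ∃ V ∈ B, x ∈ U ∧ y ∈ V ∧ Disjoint U V) :
    SecondCountableTopology X := by
  rename_i τ
  have hle : τ ≤ TopologicalSpace.generateFrom B := le_generateFrom ho
  have ht2 : @T2Space X (TopologicalSpace.generateFrom B) := by
    refine @T2Space.mk X (TopologicalSpace.generateFrom B) fun x y hxy => ?_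
    obtain ⟨U, hU, V, hV, hx, hy, hd⟩ := hs x y hxy
    exact ⟨U, V, TopologicalSpace.isOpen_generateFrom_of_mem hU,
      TopologicalSpace.isOpen_generateFrom_of_mem hV, hx, hy, hd⟩
  have hcont : @Continuous X X τ (TopologicalSpace.generateFrom B) id :=
    continuous_id_iff_le.2 hle
  have heq : τ = TopologicalSpace.generateFrom B := by
    refine le_antisymm hle fun U hU => ?_
    have hcl := @Continuous.isClosedMap X X τ (TopologicalSpace.generateFrom B) i ht2 id hcont Uᶜ
      (isClosed_compl_iff.2 hU)
    rw [image_id] at hcl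
    exact (@isClosed_compl_iff X (TopologicalSpace.generateFrom B) U).1 hcl
  exact ⟨⟨B, hB, heq⟩⟩

theorem IsNetworkOn.metrizableSpace [T2Space X] {P : Set (Set X)} {Y : Set X}
    (hP : IsNetworkOn P Y) (hc : P.Countable) (hY : IsCompact Y) :
    TopologicalSpace.MetrizableSpace Y := by
  have : CompactSpace Y := isCompact_iff_compactSpace.1 hY
  -- disjoint open neighbourhoods of pairs of separated members of the network
  have key : ∀ q : Set X × Set X, ∃ O : Set Y × Set Y, IsOpen O.1 ∧ IsOpen O.2 ∧
      Disjoint O.1 O.2 ∧ (SeparatedNhds ((↑) ⁻¹' q.1 : Set Y) ((↑) ⁻¹' q.2) →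
        (↑) ⁻¹' q.1 ⊆ O.1 ∧ (↑) ⁻¹' q.2 ⊆ O.2) := by
    intro q
    by_cases h : SeparatedNhds ((↑) ⁻¹' q.1 : Set Y) ((↑) ⁻¹' q.2)
    · obtain ⟨U, V, hU, hV, h1, h2, hd⟩ := id h
      exact ⟨(U, V), hU, hV, hd, fun _ => ⟨h1, h2⟩⟩
    · exact ⟨(∅, ∅), isOpen_empty, isOpen_empty, disjoint_bot_left, fun h' => absurd h' h⟩
  choose O hO1 hO2 hOd hO using key
  let B : Set (Set Y) := (fun q => (O q).1) '' (P ×ˢ P) ∪ (fun q => (O q).2) '' (P ×ˢ P)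
  have hB : B.Countable := ((hc.prod hc).image _).union ((hc.prod hc).image _)
  have : SecondCountableTopology Y := by
    refine secondCountableTopology_of_separating hB ?_ fun x y hxy => ?_
    · rintro _ (⟨q, -, rfl⟩ | ⟨q, -, rfl⟩)
      exacts [hO1 q, hO2 q]
    obtain ⟨U, V, hU, hV, hxU, hyV, hd⟩ := t2_separation hxy
    obtain ⟨U', hU', hU'c, hU'U⟩ := exists_mem_nhds_isClosed_subset (hU.mem_nhds hxU)
    obtain ⟨V', hV', hV'c, hV'V⟩ := exists_mem_nhds_isClosed_subset (hV.mem_nhds hyV)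
    obtain ⟨u, hu, huU⟩ := mem_nhds_subtype _ _ _ |>.1 hU'
    obtain ⟨v, hv, hvV⟩ := mem_nhds_subtype _ _ _ |>.1 hV'
    obtain ⟨A, hA, hxA, hAu⟩ := hP x x.2 u hu
    obtain ⟨C, hC, hyC, hCv⟩ := hP y y.2 v hv
    have hs : SeparatedNhds ((↑) ⁻¹' A : Set Y) ((↑) ⁻¹' C) :=
      ⟨U, V, hU, hV, ((preimage_mono hAu).trans huU).trans hU'U,
        ((preimage_mono hCv).trans hvV).trans hV'V, hd⟩
    exact ⟨_, Or.inl ⟨(A, C), ⟨hA, hC⟩, rfl⟩, _, Or.inr ⟨(A, C), ⟨hA, hC⟩, rfl⟩,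
      (hO (A, C) hs).1 hxA, (hO (A, C) hs).2 hyC, hOd _⟩
  infer_instance

end Network

/-! ### From `cs*`-networks to `cs`-networks -/

section Group

variable {G : Type u} [TopologicalSpace G] [Group G]

/-- A family `N` of subsets of `G` is a `cs`-network at the identity if for every neighborhood `U`
of `1` every sequence convergent to `1` is eventually in some member of `N` contained in `U`. -/
def IsCsNetworkAtOne (N : Set (Set G)) : Prop :=
  ∀ U ∈ 𝓝 (1 : G), ∀ s : ℕ → G, Tendsto s atTop (𝓝 1) →
    ∃ A ∈ N, A ⊆ U ∧ ∀ᶠ n in atTop, s n ∈ A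

theorem exists_countable_isCsStarNetworkAt {X : Type u} [TopologicalSpace X]
    (h : csStarCharacter X ≤ Cardinal.aleph0) (x : X) :
    ∃ N : Set (Set X), N.Countable ∧ IsCsStarNetworkAt N x := by
  have hx : csStarCharacterAt X x ≤ Cardinal.aleph0 := by
    refine le_trans ?_ h
    rw [csStarCharacter, if_neg (not_isEmpty_iff.2 ⟨x⟩)]
    exact le_ciSup (Cardinal.bddAbove_of_small) x
  have hne : {κ : Cardinal.{u} | ∃ N : Set (Set X), IsCsStarNetworkAt N x ∧
      Cardinal.mk N = κ}.Nonempty := by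
    refine ⟨_, univ, fun U hU s hs => ⟨U, mem_univ _, Subset.rfl, ?_⟩, rfl⟩
    exact Nat.frequently_atTop_iff_infinite.1 (hs.eventually_mem hU).frequently
  obtain ⟨N, hN, hcard⟩ := csInf_mem hne
  refine ⟨N, ?_, hN⟩
  rw [← Cardinal.le_aleph0_iff_set_countable, hcard]
  exact hx

/-- A countable `cs*`-network at `1` in a regular group yields a countable `cs`-network of closed
sets: the finite unions of closures of its members. -/
theorem exists_countable_isCsNetworkAtOne [RegularSpace G] {N : Set (Set G)} (hc : N.Countable)
    (hN : IsCsStarNetworkAt N (1 : G)) :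
    ∃ M : Set (Set G), M.Countable ∧ IsCsNetworkAtOne M ∧ (∀ A ∈ M, IsClosed A) ∧
      ∀ A ∈ M, ∀ B ∈ M, A ∪ B ∈ M := by
  refine ⟨(fun t => ⋃₀ (closure '' t)) '' {t | t.Finite ∧ t ⊆ N},
    (countable_ofPred_finite_subset hc).image _, ?_, ?_, ?_⟩
  · intro U hU s hs
    obtain ⟨V, hV, hVc, hVU⟩ := exists_mem_nhds_isClosed_subset hU
    -- inserting `∅` ensures that the family is the range of a sequence
    obtain ⟨f, hf⟩ : ∃ f : ℕ → Set G, insert ∅ {A ∈ N | A ⊆ V} = range f :=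
      ((hc.mono (sep_subset _ _)).insert ∅).exists_eq_range (insert_nonempty _ _)
    by_contra! hcon
    have hfV : ∀ i, f i ⊆ V := by
      intro i
      have : f i ∈ insert ∅ {A ∈ N | A ⊆ V} := hf ▸ mem_range_self i
      rcases this with h | h
      · rw [h]; exact empty_subset _
      · exact h.2
    have hfreq : ∀ k, ∃ᶠ n in atTop, ∀ i ≤ k, s n ∉ f i := by
      intro k
      have := hcon (⋃₀ (closure '' (f '' Iic k ∩ N)))
        ⟨_, ⟨((finite_Iic k).image f).inter_of_left _, inter_subset_right⟩, rfl⟩ ?_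
      · refine Frequently.mono this fun n hn i hi hni => hn ?_
        have hfi : f i ∈ insert ∅ {A ∈ N | A ⊆ V} := hf ▸ mem_range_self i
        rcases hfi with h | h
        · rw [h] at hni; exact hni.elim
        · exact ⟨_, ⟨f i, ⟨⟨i, hi, rfl⟩, h.1⟩, rfl⟩, subset_closure hni⟩
      · rintro x ⟨_, ⟨_, ⟨⟨i, -, rfl⟩, -⟩, rfl⟩, hx⟩
        exact hVU (closure_minimal (hfV i) hVc hx)
    obtain ⟨φ, hφ, hφs⟩ := extraction_forall_of_frequently hfreq
    obtain ⟨A, hA, hAV, hinf⟩ := hN V hV (s ∘ φ) (hs.comp hφ.tendsto_atTop)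
    obtain ⟨i, rfl⟩ : A ∈ range f := hf ▸ Or.inr ⟨hA, hAV⟩
    obtain ⟨n, hn, hin⟩ := hinf.exists_gt i
    exact hφs n i hin.le hn
  · rintro _ ⟨t, ht, rfl⟩
    change IsClosed (⋃₀ (closure '' t))
    rw [sUnion_image]
    exact ht.1.isClosed_biUnion fun A _ => isClosed_closure
  · rintro _ ⟨t, ht, rfl⟩ _ ⟨t', ht', rfl⟩
    exact ⟨t ∪ t', ⟨ht.1.union ht'.1, union_subset ht.2 ht'.2⟩, by
      simp only [image_union, sUnion_union]⟩

/-- Inside a given neighborhood of `1`, a countable union-closed `cs`-network has an increasing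
sequence of members such that every sequence convergent to `1` is eventually in one of them. -/
theorem IsCsNetworkAtOne.exists_monotone {M : Set (Set G)} (hM : IsCsNetworkAtOne M)
    (hc : M.Countable) (hu : ∀ A ∈ M, ∀ B ∈ M, A ∪ B ∈ M) {U : Set G} (hU : U ∈ 𝓝 (1 : G)) :
    ∃ F : ℕ → Set G, Monotone F ∧ (∀ k, F k ∈ M) ∧ (∀ k, F k ⊆ U) ∧
      ∀ s : ℕ → G, Tendsto s atTop (𝓝 1) → ∃ k, ∀ᶠ n in atTop, s n ∈ F k := by
  obtain ⟨A, hA, hAU, -⟩ := hM U hU (fun _ => 1) tendsto_const_nhds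
  obtain ⟨f, hf⟩ : ∃ f : ℕ → Set G, {A ∈ M | A ⊆ U} = range f :=
    (hc.mono (sep_subset _ _)).exists_eq_range ⟨A, hA, hAU⟩
  have hfm : ∀ i, f i ∈ M ∧ f i ⊆ U := fun i => by
    have : f i ∈ {A ∈ M | A ⊆ U} := hf ▸ mem_range_self i
    exact this
  refine ⟨accumulate f, monotone_accumulate, fun k => ?_, fun k => ?_, fun s hs => ?_⟩
  · induction k with
    | zero => simpa [accumulate_def] using (hfm 0).1
    | succ k ih => rw [accumulate_succ]; exact hu _ ih _ (hfm _).1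
  · exact iUnion₂_subset fun i _ => (hfm i).2
  · obtain ⟨A, hA, hAU, hs⟩ := hM U hU s hs
    obtain ⟨i, rfl⟩ : A ∈ range f := hf ▸ ⟨hA, hAU⟩
    exact ⟨i, hs.mono fun n hn => subset_accumulate hn⟩

end Group

/-! ### Closures of countable sets -/

section Words

variable {G : Type u} [Group G]

/-- For each length `r`, the family of all sets `s N₁ ⋯ Nᵣ` with `s ∈ S` and `N₁, …, Nᵣ ∈ M`. -/
def translatedWords (S : Set G) (M : Set (Set G)) : ℕ → Set (Set G)
  | 0 => (fun s => {s}) '' S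
  | r + 1 => image2 (fun P N => P * N) (translatedWords S M r) M

theorem countable_translatedWords {S : Set G} {M : Set (Set G)} (hS : S.Countable)
    (hc : M.Countable) : (⋃ r, translatedWords S M r).Countable := by
  refine countable_iUnion fun r => ?_
  induction r with
  | zero => exact hS.image _
  | succ r ih => exact ih.image2 hc _

end Words

section FanOrMetrizable

variable {G : Type u} [TopologicalSpace G] [Group G] [IsTopologicalGroup G]

/-- The closure of `S` has the network of all `s N₁ ⋯ Nᵣ`: the points at which these sets form a
network are sequentially closed, since `u n → y` puts `(u n)⁻¹ * y` into a small `N ∈ M`, which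
prolongs a word around `u n` to a word around `y`. For countable `S` and `M` this network is
countable. -/
theorem isNetworkOn_closure [SequentialSpace G] {M : Set (Set G)} (hM : IsCsNetworkAtOne M)
    (S : Set G) : IsNetworkOn (⋃ r, translatedWords S M r) (closure S) := by
  let Y : Set G := {y | ∀ U ∈ 𝓝 y, ∃ A ∈ ⋃ r, translatedWords S M r, y ∈ A ∧ A ⊆ U}
  have hSY : S ⊆ Y := fun y hy U hU =>
    ⟨{y}, mem_iUnion.2 ⟨0, y, hy, rfl⟩, rfl, singleton_subset_iff.2 (mem_of_mem_nhds hU)⟩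
  have hY : IsSeqClosed Y := by
    intro u y hu huy U hU
    have hcont : Tendsto (fun p : G × G × G => p.1 * p.2.1 * p.2.2) (𝓝 (y, 1, 1)) (𝓝 y) := by
      have : Continuous fun p : G × G × G => p.1 * p.2.1 * p.2.2 := by fun_prop
      simpa using this.tendsto (y, 1, 1)
    have hmem := hcont hU
    rw [mem_map, nhds_prod_eq, nhds_prod_eq, mem_prod_iff] at hmem
    obtain ⟨W, hW, VV, hVV, hsub⟩ := hmem
    obtain ⟨V, hV, V', hV', hVsub⟩ := mem_prod_iff.1 hVV
    have hmul : ∀ g ∈ W, ∀ v ∈ V, ∀ w ∈ V', g * v * w ∈ U := fun g hg v hv w hw =>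
      hsub (show (g, v, w) ∈ W ×ˢ VV from ⟨hg, hVsub ⟨hv, hw⟩⟩)
    have hlim : Tendsto (fun n => (u n)⁻¹ * y) atTop (𝓝 1) := by
      simpa using huy.inv.mul_const y
    obtain ⟨B, hB, hBV, hev⟩ := hM V' hV' _ hlim
    obtain ⟨n, hn, hnW⟩ := (hev.and (huy.eventually_mem hW)).exists
    have hnhds : {g | (u n)⁻¹ * g ∈ V} ∈ 𝓝 (u n) := by
      have : Tendsto (fun g => (u n)⁻¹ * g) (𝓝 (u n)) (𝓝 1) := by
        have h : Continuous fun g => (u n)⁻¹ * g := by fun_prop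
        simpa using h.tendsto (u n)
      exact this hV
    obtain ⟨A, hA, hnA, hAV⟩ := hu n _ hnhds
    obtain ⟨r, hr⟩ := mem_iUnion.1 hA
    refine ⟨A * B, mem_iUnion.2 ⟨r + 1, A, hr, B, hB, rfl⟩, ?_, ?_⟩
    · simpa using mul_mem_mul hnA hn
    · rintro _ ⟨a, ha, b, hb, rfl⟩
      simpa using hmul (u n) hnW _ (hAV ha) b (hBV hb)
  exact fun y hy => closure_minimal hSY hY.isClosed hy

/-- The identity is a `G_δ`-point relative to the closure of any countable set. -/
theorem exists_closed_nhds_one_inter_closure [SequentialSpace G] [T1Space G] {M : Set (Set G)}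
    (hM : IsCsNetworkAtOne M) (hc : M.Countable) {S : Set G} (hS : S.Countable) :
    ∃ V : ℕ → Set G, (∀ k, V k ∈ 𝓝 1 ∧ IsClosed (V k)) ∧
      ∀ g ∈ closure S, (∀ k, g ∈ V k) → g = 1 := by
  let P := ⋃ r, translatedWords S M r
  have hP : P.Countable := countable_translatedWords hS hc
  obtain ⟨f, hf⟩ : ∃ f : ℕ → Set G, insert ∅ {A ∈ P | (1 : G) ∉ closure A} = range f :=
    ((hP.mono (sep_subset _ _)).insert ∅).exists_eq_range (insert_nonempty _ _)
  have hf1 : ∀ k, (1 : G) ∉ closure (f k) := by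
    intro k
    have : f k ∈ insert ∅ {A ∈ P | (1 : G) ∉ closure A} := hf ▸ mem_range_self k
    rcases this with h | h
    · simp [h]
    · exact h.2
  choose V hV hVc hVf using fun k =>
    exists_mem_nhds_isClosed_subset (isClosed_closure.isOpen_compl.mem_nhds (hf1 k))
  refine ⟨V, fun k => ⟨hV k, hVc k⟩, fun g hg hgV => ?_⟩
  by_contra hne
  obtain ⟨U, hU, hUc, hU1⟩ :=
    exists_mem_nhds_isClosed_subset
      (isOpen_compl_singleton.mem_nhds (show g ∈ ({1} : Set G)ᶜ from hne))
  obtain ⟨A, hA, hgA, hAU⟩ := isNetworkOn_closure hM S g hg U hU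
  obtain ⟨k, rfl⟩ : A ∈ range f :=
    hf ▸ Or.inr ⟨hA, fun h => hU1 (closure_minimal hAU hUc h) rfl⟩
  exact hVf k (hgV k) (subset_closure hgA)

/-! ### Sequential barriers and metrizability -/

/-- Every neighborhood of `1` contains a member of `M` that is a sequential barrier at `1`, i.e.
that every sequence convergent to `1` eventually enters. -/
def HasBarriersAtOne (M : Set (Set G)) : Prop :=
  ∀ U ∈ 𝓝 (1 : G), ∃ A ∈ M, A ⊆ U ∧ ∀ s : ℕ → G, Tendsto s atTop (𝓝 1) → ∀ᶠ n in atTop, s n ∈ A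

/-- A sequential group that is weakly first countable at the identity is metrizable. The barriers
`B n` are neighborhoods of `1`, because the points `x` with `x * B m ⊆ B n` for some `m` form a
sequentially open set. -/
theorem HasBarriersAtOne.metrizableSpace [SequentialSpace G] [T1Space G] {M : Set (Set G)}
    (hM : HasBarriersAtOne M) (hc : M.Countable) : TopologicalSpace.MetrizableSpace G := by
  let M' : Set (Set G) :=
    {A ∈ M | ∀ s : ℕ → G, Tendsto s atTop (𝓝 1) → ∀ᶠ n in atTop, s n ∈ A}
  obtain ⟨f, hf⟩ : ∃ f : ℕ → Set G, M' = range f := by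
    obtain ⟨A, hA, -, hs⟩ := hM univ univ_mem
    exact (hc.mono (sep_subset _ _)).exists_eq_range ⟨A, hA, hs⟩
  have hfb : ∀ k, ∀ s : ℕ → G, Tendsto s atTop (𝓝 1) → ∀ᶠ n in atTop, s n ∈ f k := by
    intro k
    have : f k ∈ M' := hf ▸ mem_range_self k
    exact this.2
  let B := dissipate f
  have hB : ∀ k, ∀ s : ℕ → G, Tendsto s atTop (𝓝 1) → ∀ᶠ n in atTop, s n ∈ B k := by
    intro k s hs
    simp only [B, mem_dissipate]
    exact (eventually_all_finite (finite_Iic k)).2 fun i _ => hfb i s hs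
  have hBU : ∀ U ∈ 𝓝 (1 : G), ∃ k, B k ⊆ U := by
    intro U hU
    obtain ⟨A, hA, hAU, hs⟩ := hM U hU
    obtain ⟨k, rfl⟩ : A ∈ range f := hf ▸ ⟨hA, hs⟩
    exact ⟨k, (dissipate_subset le_rfl).trans hAU⟩
  have hB1 : ∀ k, (1 : G) ∈ B k := fun k => by
    obtain ⟨n, hn⟩ := (hB k (fun _ => 1) tendsto_const_nhds).exists
    exact hn
  have hBnhds : ∀ n, B n ∈ 𝓝 (1 : G) := by
    intro n
    let W : Set G := {x | ∃ m, ∀ b ∈ B m, x * b ∈ B n}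
    have hW : IsOpen W := by
      rw [← isClosed_compl_iff]
      refine IsSeqClosed.isClosed fun u x hu hux hx => ?_
      obtain ⟨m, hm⟩ := hx
      have hu' : ∀ j, ∃ b ∈ B j, u j * b ∉ B n := fun j => by
        have := hu j
        simp only [W, mem_compl_iff, mem_ofPred_eq, not_exists, not_forall] at this
        obtain ⟨b, hb, h⟩ := this j
        exact ⟨b, hb, h⟩
      choose b hb hub using hu'
      have hb1 : Tendsto b atTop (𝓝 1) := by
        intro U hU
        obtain ⟨k, hk⟩ := hBU U hU
        rw [mem_map]
        filter_upwards [eventually_ge_atTop k] with j hj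
        exact hk (antitone_dissipate hj (hb j))
      have hlim : Tendsto (fun j => x⁻¹ * u j * b j) atTop (𝓝 1) := by
        simpa using (hux.const_mul x⁻¹).mul hb1
      obtain ⟨j, hj⟩ := (hB m _ hlim).exists
      exact hub j (by simpa [mul_assoc] using hm _ hj)
    refine mem_of_superset (hW.mem_nhds ⟨n, fun b hb => by simpa using hb⟩) ?_
    rintro x ⟨m, hm⟩
    simpa using hm 1 (hB1 m)
  have hbasis : (𝓝 (1 : G)).HasBasis (fun _ : ℕ => True) B :=
    ⟨fun U => ⟨fun hU => by simpa using hBU U hU,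
      fun ⟨k, _, hk⟩ => mem_of_superset (hBnhds k) hk⟩⟩
  have : IsCountablyGenerated (𝓝 (1 : G)) := hbasis.isCountablyGenerated
  let : UniformSpace G := IsTopologicalGroup.rightUniformSpace G
  have : IsCountablyGenerated (uniformity G) := by
    rw [uniformity_eq_comap_nhds_one']
    infer_instance
  exact UniformSpace.metrizableSpace

/-! ### Fans in non-metrizable groups -/

/-- Sequences `x k` convergent to `1`, such that no sequence choosing its terms from infinitely many
different spokes `x k` converges. Up to repetitions and terms equal to `1`, they form together with
`1` a closed Fréchet–Urysohn fan; a spoke may be eventually constant. -/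
def IsFan (x : ℕ → ℕ → G) : Prop :=
  (∀ k, Tendsto (x k) atTop (𝓝 1)) ∧
    ∀ (φ i : ℕ → ℕ) (g : G), StrictMono φ → ¬ Tendsto (fun l => x (φ l) (i l)) atTop (𝓝 g)

/-- If some neighborhood `U` contains no barrier from `M`, then for the increasing sets `F k ⊆ U` of
`IsCsNetworkAtOne.exists_monotone` there are sequences `x k → 1` outside `F k`. A diagonal sequence
is not eventually in any `F k`, so it does not converge to `1`. Initial terms are deleted so that the
`k`-th spoke lies in the `k`-th of a decreasing sequence of neighborhoods whose intersection meets
the closure of the spokes in `{1}` at most; this excludes all other limits. -/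
theorem exists_isFan [SequentialSpace G] [T1Space G] {M : Set (Set G)}
    (hM : IsCsNetworkAtOne M) (hc : M.Countable) (hu : ∀ A ∈ M, ∀ B ∈ M, A ∪ B ∈ M)
    (hb : ¬ HasBarriersAtOne M) : ∃ x : ℕ → ℕ → G, IsFan x := by
  simp only [HasBarriersAtOne, not_forall] at hb
  obtain ⟨U, hU, hb⟩ := hb
  obtain ⟨F, hFm, hFM, hFU, hF⟩ := hM.exists_monotone hc hu hU
  have hx : ∀ k, ∃ s : ℕ → G, Tendsto s atTop (𝓝 1) ∧ ∀ n, s n ∉ F k := by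
    intro k
    by_contra! h
    refine hb ⟨F k, hFM k, hFU k, fun s hs => ?_⟩
    by_contra hns
    obtain ⟨φ, hφ, hsφ⟩ := extraction_of_frequently_atTop (not_eventually.1 hns)
    obtain ⟨n, hn⟩ := h _ (hs.comp hφ.tendsto_atTop)
    exact hsφ n hn
  choose x hx hxF using hx
  have hS : (⋃ k, range (x k)).Countable := countable_iUnion fun k => countable_range _
  obtain ⟨V, hV, hV1⟩ := exists_closed_nhds_one_inter_closure hM hc hS
  have hev : ∀ k, ∃ N, ∀ i ≥ N, x k i ∈ dissipate V k := by
    intro k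
    have h : dissipate V k ∈ 𝓝 (1 : G) :=
      (biInter_mem (finite_Iic k)).2 fun i _ => (hV i).1
    exact eventually_atTop.1 ((hx k).eventually_mem h)
  choose N hN using hev
  refine ⟨fun k i => x k (i + N k), fun k => (hx k).comp (tendsto_add_atTop_nat _), ?_⟩
  intro φ i g hφ hlim
  have hg1 : g = 1 := by
    refine hV1 g (mem_closure_of_tendsto hlim (Eventually.of_forall fun l =>
      mem_iUnion.2 ⟨φ l, mem_range_self _⟩)) fun j => ?_
    refine (hV j).2.mem_of_tendsto hlim ?_
    filter_upwards [eventually_ge_atTop j] with l hl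
    exact dissipate_subset (hl.trans (hφ.id_le l)) (hN (φ l) _ (Nat.le_add_left _ _))
  subst hg1
  obtain ⟨m, hm⟩ := hF _ hlim
  obtain ⟨l, hl, hml⟩ := (hm.and (eventually_ge_atTop m)).exists
  exact hxF (φ l) _ (hFm (hml.trans (hφ.id_le l)) hl)

/-- In the presence of a fan `x`, for every sequence `s` convergent to `1` some finite intersection
of members of the network captures `s` and is sequentially compact. Otherwise choose sequences
`a k` without convergent subsequences in the decreasing intersections `P k`: the set of products
`a k i * x k i ≠ 1` is closed and has `1` in its closure. -/
theorem IsFan.exists_isSeqCompact_sInter [SequentialSpace G] [T1Space G] {x : ℕ → ℕ → G}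
    (hx : IsFan x) {M : Set (Set G)} (hM : IsCsNetworkAtOne M) (hc : M.Countable)
    (hcl : ∀ A ∈ M, IsClosed A) {s : ℕ → G} (hs : Tendsto s atTop (𝓝 1)) :
    ∃ t : Set (Set G), t.Finite ∧ t ⊆ M ∧ IsSeqCompact (⋂₀ t) ∧ ∀ᶠ n in atTop, s n ∈ ⋂₀ t := by
  obtain ⟨f, hf⟩ : ∃ f : ℕ → Set G, {A ∈ M | ∀ᶠ n in atTop, s n ∈ A} = range f := by
    obtain ⟨A, hA, -, hsA⟩ := hM univ univ_mem s hs
    exact (hc.mono (sep_subset _ _)).exists_eq_range ⟨A, hA, hsA⟩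
  have hfm : ∀ k, f k ∈ M ∧ ∀ᶠ n in atTop, s n ∈ f k := by
    intro k
    have : f k ∈ {A ∈ M | ∀ᶠ n in atTop, s n ∈ A} := hf ▸ mem_range_self k
    exact this
  let P := dissipate f
  have hPU : ∀ U ∈ 𝓝 (1 : G), ∃ k, P k ⊆ U := by
    intro U hU
    obtain ⟨A, hA, hAU, hsA⟩ := hM U hU s hs
    obtain ⟨k, rfl⟩ : A ∈ range f := hf ▸ ⟨hA, hsA⟩
    exact ⟨k, (dissipate_subset le_rfl).trans hAU⟩
  have hPc : ∀ k, IsClosed (P k) := fun k =>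
    isClosed_biInter fun i _ => hcl _ (hfm i).1
  obtain ⟨k, hk⟩ : ∃ k, IsSeqCompact (P k) := by
    by_contra! h
    simp only [IsSeqCompact, not_forall] at h
    choose a ha hna using h
    have hnot : ∀ k g, ∀ φ : ℕ → ℕ, StrictMono φ → ¬ Tendsto (a k ∘ φ) atTop (𝓝 g) :=
      fun k g φ hφ hlim => hna k ⟨g, (hPc k).mem_of_tendsto hlim
        (Eventually.of_forall fun l => ha k _), φ, hφ, hlim⟩
    -- `g ≠ 1` is imposed since single products may happen to equal `1`
    let T : Set G := {g | g ≠ 1 ∧ ∃ k i, g = a k i * x k i}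
    have hTc : IsSeqClosed T := by
      intro z g hz hzg
      choose hz1 k i hzki using hz
      obtain ⟨φ, hφ, ⟨c, hkc⟩ | hkφ⟩ := exists_subseq_const_or_strictMono k
      · obtain ⟨ψ, hψ, ⟨d, hid⟩ | hiψ⟩ := exists_subseq_const_or_strictMono (i ∘ φ)
        · -- the sequence takes the same value infinitely often
          have hconst : ∀ l, z (φ (ψ l)) = a c d * x c d := fun l => by
            rw [hzki, hkc]
            have := hid l
            simp only [Function.comp] at this
            rw [this]
          have hlim : Tendsto (fun l => z (φ (ψ l))) atTop (𝓝 g) :=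
            hzg.comp (hφ.comp hψ).tendsto_atTop
          have hg : g = z (φ (ψ 0)) := by
            refine tendsto_nhds_unique hlim ?_
            simp only [hconst]
            exact tendsto_const_nhds
          rw [hg]
          exact ⟨hz1 _, _, _, hzki _⟩
        · -- infinitely many terms from one spoke: the sequence `a c` subconverges
          refine absurd ?_ (hnot c g (i ∘ φ ∘ ψ) hiψ)
          have h1 : Tendsto (fun l => z (φ (ψ l))) atTop (𝓝 g) :=
            hzg.comp (hφ.comp hψ).tendsto_atTop
          have h2 : Tendsto (fun l => x c (i (φ (ψ l)))) atTop (𝓝 1) :=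
            (hx.1 c).comp hiψ.tendsto_atTop
          have h3 := h1.mul h2.inv
          rw [inv_one, mul_one] at h3
          refine h3.congr fun l => ?_
          rw [hzki, hkc]
          simp
      · -- terms from infinitely many spokes: a diagonal of the fan converges
        refine absurd ?_ (hx.2 (k ∘ φ) (i ∘ φ) g hkφ)
        have h1 : Tendsto (fun l => a (k (φ l)) (i (φ l))) atTop (𝓝 1) := by
          intro U hU
          obtain ⟨m, hm⟩ := hPU U hU
          rw [mem_map]
          filter_upwards [eventually_ge_atTop m] with l hl
          exact hm (antitone_dissipate (hl.trans (hkφ.id_le l)) (ha _ _))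
        have h2 := h1.inv.mul (hzg.comp hφ.tendsto_atTop)
        rw [inv_one, one_mul] at h2
        refine h2.congr fun l => ?_
        simp [hzki]
    have h1T : (1 : G) ∈ closure T := by
      refine mem_closure_iff_nhds.2 fun U hU => ?_
      obtain ⟨V, hV, hVU⟩ : ∃ V ∈ 𝓝 (1 : G), ∀ v ∈ V, ∀ w ∈ V, v * w ∈ U :=
        exists_nhds_one_split hU
      obtain ⟨k, hk⟩ := hPU V hV
      have hfr : ∃ᶠ i in atTop, a k i * x k i ≠ 1 := by
        intro hev
        simp only [ne_eq, not_not] at hev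
        refine hnot k 1 id strictMono_id ?_
        have := (hx.1 k).inv
        rw [inv_one] at this
        refine this.congr' ?_
        filter_upwards [hev] with i hi
        exact (eq_inv_of_mul_eq_one_left hi).symm
      obtain ⟨i, hi, hxi⟩ := (hfr.and_eventually ((hx.1 k).eventually_mem hV)).exists
      exact ⟨_, hVU _ (hk (ha k i)) _ hxi, hi, k, i, rfl⟩
    rw [hTc.isClosed.closure_eq] at h1T
    exact h1T.1 rfl
  have hPk : ⋂₀ (f '' Iic k) = P k := by
    rw [sInter_image]; rfl
  refine ⟨f '' Iic k, (finite_Iic k).image _, ?_, hPk ▸ hk, ?_⟩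
  · rintro _ ⟨i, -, rfl⟩
    exact (hfm i).1
  · rw [sInter_image]
    simp only [mem_iInter]
    exact (eventually_all_finite (finite_Iic k)).2 fun i _ => (hfm i).2

end FanOrMetrizable

/-! ### Sequentially compact sets -/

section SeqCompact

variable {G : Type u} [TopologicalSpace G] [Group G] [IsTopologicalGroup G]

/-- Sequentially compact sets are separable. If a neighborhood `U` of `1` contained no `B ∈ M` with
finitely many translates covering `C`, a sequence in `C` could be chosen greedily with
`p m ∉ p l * F l` for `l < m`, for increasing sets `F l ⊆ U` in `M` that capture all sequences
convergent to `1`; but consecutive quotients of a convergent subsequence tend to `1`, so they are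
eventually in one of the `F l`. -/
theorem IsSeqCompact.exists_countable_subset_closure {M : Set (Set G)} (hM : IsCsNetworkAtOne M)
    (hc : M.Countable) (hu : ∀ A ∈ M, ∀ B ∈ M, A ∪ B ∈ M) {C : Set G} (hC : IsSeqCompact C) :
    ∃ S : Set G, S.Countable ∧ C ⊆ closure S := by
  -- finitely many translates of a small member of the network cover `C`
  have key : ∀ U ∈ 𝓝 (1 : G), ∃ B ∈ M, B ⊆ U ∧ ∃ Φ : Set G, Φ.Finite ∧ C ⊆ Φ * B := by
    intro U hU
    obtain ⟨F, hFm, hFM, hFU, hF⟩ := hM.exists_monotone hc hu hU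
    by_contra! hcon
    -- the first component of `p l` is the index of the set `F k` whose translate is avoided later on
    obtain ⟨p, hpC, hp⟩ := exists_seq_of_forall_finset_exists (fun p : ℕ × G => p.2 ∈ C)
      (fun p q => p.1 < q.1 ∧ q.2 ∉ p.2 • F p.1) (by
        intro s _
        obtain ⟨y, hyC, hy⟩ := not_subset.1
          (hcon (F (s.sup Prod.fst)) (hFM _) (hFU _) (Prod.snd '' (s : Set (ℕ × G)))
            (s.finite_toSet.image _))
        refine ⟨(s.sup Prod.fst + 1, y), hyC, fun q hq =>
          ⟨Nat.lt_succ_of_le (Finset.le_sup (f := Prod.fst) hq), fun hyq => hy ?_⟩⟩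
        obtain ⟨b, hb, hby⟩ := hyq
        exact ⟨q.2, ⟨q, hq, rfl⟩, b, hFm (Finset.le_sup (f := Prod.fst) hq) hb, hby⟩)
    obtain ⟨c, -, φ, hφ, hlim⟩ := hC hpC
    have hlim' : Tendsto (fun l => (p (φ l)).2⁻¹ * (p (φ (l + 1))).2) atTop (𝓝 1) := by
      have := hlim.inv.mul (hlim.comp (tendsto_add_atTop_nat 1))
      simpa using this
    obtain ⟨m, hm⟩ := hF _ hlim'
    have hmono : StrictMono fun l => (p (φ l)).1 := fun i j hij => (hp _ _ (hφ hij)).1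
    obtain ⟨l, hl, hml⟩ := (hm.and (eventually_ge_atTop m)).exists
    refine (hp _ _ (hφ (Nat.lt_succ_self l))).2 ?_
    rw [mem_smul_set_iff_inv_smul_mem]
    exact hFm (hml.trans (hmono.id_le l)) hl
  have hΦ : ∀ B : {B // B ∈ M ∧ ∃ Φ : Set G, Φ.Finite ∧ C ⊆ Φ * B},
      ∃ Φ : Set G, Φ.Finite ∧ C ⊆ Φ * B.1 := fun B => B.2.2
  choose Φ hΦf hΦC using hΦ
  have : Countable {B // B ∈ M ∧ ∃ Φ : Set G, Φ.Finite ∧ C ⊆ Φ * B} :=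
    (hc.mono (fun B hB => hB.1) :
      {B : Set G | B ∈ M ∧ ∃ Φ : Set G, Φ.Finite ∧ C ⊆ Φ * B}.Countable).to_subtype
  refine ⟨⋃ B, Φ B, countable_iUnion fun B => (hΦf B).countable, fun y hy => ?_⟩
  refine mem_closure_iff_nhds.2 fun t ht => ?_
  have hU : {u : G | y * u⁻¹ ∈ t} ∈ 𝓝 (1 : G) := by
    have h : Continuous fun u : G => y * u⁻¹ := by fun_prop
    have := h.tendsto 1
    rw [inv_one, mul_one] at this
    exact this ht
  obtain ⟨B, hB, hBU, hBΦ⟩ := key _ hU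
  obtain ⟨g, hg, b, hb, hgb⟩ := hΦC ⟨B, hB, hBΦ⟩ hy
  refine ⟨g, ?_, mem_iUnion.2 ⟨_, hg⟩⟩
  have : y * b⁻¹ ∈ t := hBU hb
  rwa [← hgb, mul_inv_cancel_right] at this

theorem IsSeqCompact.isCompact_and_metrizableSpace [SequentialSpace G] [T1Space G]
    {M : Set (Set G)} (hM : IsCsNetworkAtOne M) (hc : M.Countable)
    (hu : ∀ A ∈ M, ∀ B ∈ M, A ∪ B ∈ M) {C : Set G} (hC : IsSeqCompact C) :
    IsCompact C ∧ TopologicalSpace.MetrizableSpace C := by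
  obtain ⟨S, hS, hCS⟩ := hC.exists_countable_subset_closure hM hc hu
  have hP : IsNetworkOn (⋃ r, translatedWords S M r) C :=
    fun y hy => isNetworkOn_closure hM S y (hCS hy)
  have hPc := countable_translatedWords hS hc
  have hcomp : IsCompact C := IsLindelof.isCompact hC.isCountablyCompact (hP.isLindelof hPc)
  exact ⟨hcomp, hP.metrizableSpace hPc hcomp⟩

theorem IsSeqCompact.union {X : Type*} [TopologicalSpace X] {A B : Set X} (hA : IsSeqCompact A)
    (hB : IsSeqCompact B) : IsSeqCompact (A ∪ B) := by
  intro u hu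
  rcases frequently_or_distrib.1 (Frequently.of_forall (f := atTop) hu) with h | h
  · obtain ⟨a, ha, φ, hφ⟩ := hA.subseq_of_frequently_in h
    exact ⟨a, Or.inl ha, φ, hφ⟩
  · obtain ⟨a, ha, φ, hφ⟩ := hB.subseq_of_frequently_in h
    exact ⟨a, Or.inr ha, φ, hφ⟩

theorem isSeqCompact_singleton {X : Type*} [TopologicalSpace X] (x : X) :
    IsSeqCompact ({x} : Set X) := fun _ hu =>
  ⟨x, rfl, id, strictMono_id, tendsto_const_nhds.congr fun n => (hu n).symm⟩

theorem IsSeqCompact.mul {A B : Set G} (hA : IsSeqCompact A) (hB : IsSeqCompact B) :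
    IsSeqCompact (A * B) := by
  intro u hu
  choose v hv w hw hvw using hu
  obtain ⟨a, ha, φ, hφ, hφa⟩ := hA hv
  obtain ⟨b, hb, ψ, hψ, hψb⟩ := hB (fun n => hw (φ n))
  refine ⟨a * b, mul_mem_mul ha hb, φ ∘ ψ, hφ.comp hψ,
    ((hφa.comp hψ.tendsto_atTop).mul hψb).congr fun n => hvw _⟩

theorem IsSeqCompact.inv {A : Set G} (hA : IsSeqCompact A) : IsSeqCompact A⁻¹ := by
  rw [← image_inv_eq_inv]
  exact hA.image continuous_inv.seqContinuous

theorem IsSeqCompact.pow {A : Set G} (hA : IsSeqCompact A) (n : ℕ) : IsSeqCompact (A ^ n) := by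
  induction n with
  | zero =>
    rw [pow_zero, ← singleton_one]
    exact isSeqCompact_singleton 1
  | succ n ih => rw [pow_succ]; exact ih.mul hA

end SeqCompact

/-! ### Inductive topologies on sequential spaces -/

section InductiveTopology

/-- If every convergent sequence is, together with its limit, eventually contained in a member of
a family of closed sets, then a sequential space has the inductive topology with respect to this
family. -/
theorem hasInductiveTopology_of_seq {X : Type u} [TopologicalSpace X] [SequentialSpace X]
    {C : Set (Set X)} (hC : ∀ A ∈ C, IsClosed A)
    (h : ∀ (u : ℕ → X) (x : X), Tendsto u atTop (𝓝 x) →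
      ∃ A ∈ C, x ∈ A ∧ ∀ᶠ n in atTop, u n ∈ A) : HasInductiveTopology X C := by
  refine ⟨eq_univ_of_forall fun x => ?_, IsCoherentWith.of_isClosed fun t ht => ?_⟩
  · obtain ⟨A, hA, hx, -⟩ := h (fun _ => x) x tendsto_const_nhds
    exact ⟨A, hA, hx⟩
  · refine IsSeqClosed.isClosed fun u x hu hux => ?_
    obtain ⟨A, hA, -, hev⟩ := h u x hux
    have hcl : IsClosed (A ∩ t) := by
      rw [← Subtype.image_preimage_coe]
      exact (hC A hA).isClosedEmbedding_subtypeVal.isClosedMap _ (ht A hA)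
    exact (hcl.mem_of_tendsto hux (hev.mono fun n hn => ⟨hn, hu n⟩)).2

theorem IsClosed.sequentialSpace {X : Type*} [TopologicalSpace X] [SequentialSpace X] {Y : Set X}
    (hY : IsClosed Y) : SequentialSpace Y := by
  refine ⟨fun F hF => ?_⟩
  have hcl : IsSeqClosed (Subtype.val '' F) := by
    intro u x hu hux
    choose z hz hzu using hu
    have hx : x ∈ Y := hY.mem_of_tendsto hux (Eventually.of_forall fun n => hzu n ▸ (z n).2)
    refine ⟨⟨x, hx⟩, hF hz (tendsto_subtype_rng.2 ?_), rfl⟩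
    simpa only [hzu] using hux
  rw [← preimage_image_eq F Subtype.val_injective]
  exact hcl.isClosed.preimage continuous_subtype_val

end InductiveTopology

/-! ### The open subgroup -/

section OpenSubgroup

variable {G : Type u} [TopologicalSpace G] [Group G] [IsTopologicalGroup G]

/-- A topological group is the product of an open subgroup and the discrete space of its cosets. -/
noncomputable def Subgroup.homeomorphProdQuotient (H : Subgroup G) (hH : IsOpen (H : Set G)) :
    G ≃ₜ H × (G ⧸ H) where
  toFun g := (⟨(Quotient.out (g : G ⧸ H))⁻¹ * g,
    QuotientGroup.eq.1 (QuotientGroup.out_eq' (g : G ⧸ H))⟩, (g : G ⧸ H))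
  invFun p := Quotient.out p.2 * p.1
  left_inv g := by simp
  right_inv p := by
    have h : ((Quotient.out p.2 * p.1 : G) : G ⧸ H) = p.2 := by
      rw [QuotientGroup.mk_mul_of_mem _ p.1.2]
      exact QuotientGroup.out_eq' p.2
    refine Prod.ext (Subtype.ext ?_) h
    simp only [h, inv_mul_cancel_left]
  continuous_toFun := by
    have : DiscreteTopology (G ⧸ H) := QuotientGroup.discreteTopology hH
    have hq : Continuous fun g : G => (g : G ⧸ H) := QuotientGroup.continuous_mk
    have hout : Continuous fun q : G ⧸ H => (Quotient.out q : G) := continuous_of_discreteTopology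
    exact (((hout.comp hq).inv.mul continuous_id).subtype_mk _).prodMk hq
  continuous_invFun := by
    have : DiscreteTopology (G ⧸ H) := QuotientGroup.discreteTopology hH
    have hout : Continuous fun q : G ⧸ H => (Quotient.out q : G) := continuous_of_discreteTopology
    exact (hout.comp continuous_snd).mul (continuous_subtype_val.comp continuous_fst)

/-- The subgroup `⋃ n, A n ^ n` generated by an increasing sequence of symmetric sets `A n`. -/
def subgroupOfMonotone (A : ℕ → Set G) (hA : Monotone A)
    (hinv : ∀ n, (A n)⁻¹ = A n) : Subgroup G where
  carrier := ⋃ n, A n ^ n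
  one_mem' := mem_iUnion.2 ⟨0, by simp⟩
  mul_mem' := by
    intro a b ha hb
    obtain ⟨n, hn⟩ := mem_iUnion.1 ha
    obtain ⟨m, hm⟩ := mem_iUnion.1 hb
    refine mem_iUnion.2 ⟨n + m, ?_⟩
    rw [pow_add]
    exact mul_mem_mul (pow_subset_pow_left (hA (Nat.le_add_right n m)) hn)
      (pow_subset_pow_left (hA (Nat.le_add_left m n)) hm)
  inv_mem' := by
    intro a ha
    obtain ⟨n, hn⟩ := mem_iUnion.1 ha
    refine mem_iUnion.2 ⟨n, ?_⟩
    rw [← hinv n, inv_pow]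
    exact inv_mem_inv.2 hn

/-- A countable family of sequentially compact sets that captures all sequences convergent to `1`
generates an open subgroup that is covered by countably many sequentially compact sets `C n`, which
capture all convergent sequences of the subgroup. -/
theorem exists_open_subgroup_of_isSeqCompact [SequentialSpace G] [T1Space G] {K : Set (Set G)}
    (hc : K.Countable) (hK : ∀ A ∈ K, IsSeqCompact A)
    (hs : ∀ s : ℕ → G, Tendsto s atTop (𝓝 1) → ∃ A ∈ K, ∀ᶠ n in atTop, s n ∈ A) :
    ∃ (H : Subgroup G) (C : ℕ → Set G), IsOpen (H : Set G) ∧ (∀ n, C n ⊆ H) ∧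
      (∀ n, IsSeqCompact (C n)) ∧ ∀ (u : ℕ → G), ∀ x ∈ H, Tendsto u atTop (𝓝 x) →
        ∃ n, x ∈ C n ∧ ∀ᶠ j in atTop, u j ∈ C n := by
  obtain ⟨f, hf⟩ : ∃ f : ℕ → Set G, K = range f := by
    obtain ⟨A, hA, -⟩ := hs (fun _ => 1) tendsto_const_nhds
    exact hc.exists_eq_range ⟨A, hA⟩
  let A : ℕ → Set G := fun n => {1} ∪ (accumulate f n ∪ (accumulate f n)⁻¹)
  have hAm : Monotone A := fun m n hmn => union_subset_union_right _
    (union_subset_union (monotone_accumulate hmn) (inv_subset_inv.2 (monotone_accumulate hmn)))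
  have hA1 : ∀ n, (1 : G) ∈ A n := fun n => Or.inl rfl
  have hAinv : ∀ n, (A n)⁻¹ = A n := fun n => by
    simp only [A, union_inv, inv_inv, inv_singleton, inv_one, union_comm]
  have hacc : ∀ n, IsSeqCompact (accumulate f n) := by
    intro n
    have hfn : ∀ n, IsSeqCompact (f n) := fun n => hK _ (hf ▸ mem_range_self n)
    induction n with
    | zero => simpa [accumulate_def] using hfn 0
    | succ n ih => rw [accumulate_succ]; exact ih.union (hfn _)
  have hAc : ∀ n, IsSeqCompact (A n) := fun n =>
    (isSeqCompact_singleton 1).union ((hacc n).union (hacc n).inv)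
  let H := subgroupOfMonotone A hAm hAinv
  have hcap : ∀ (u : ℕ → G), ∀ x ∈ H, Tendsto u atTop (𝓝 x) →
      ∃ n, x ∈ A n ^ n ∧ ∀ᶠ j in atTop, u j ∈ A n ^ n := by
    intro u x hx hux
    obtain ⟨n, hn⟩ := mem_iUnion.1 hx
    have hlim : Tendsto (fun j => x⁻¹ * u j) atTop (𝓝 1) := by
      simpa using hux.const_mul x⁻¹
    obtain ⟨B, hB, hev⟩ := hs _ hlim
    obtain ⟨m, rfl⟩ : B ∈ range f := hf ▸ hB
    have hsub : A n ^ n * A m ⊆ A (n + m + 1) ^ (n + m + 1) := by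
      refine (mul_subset_mul (pow_subset_pow (hAm (by omega)) (hA1 _) (Nat.le_add_right n m))
        (hAm (by omega))).trans (pow_succ _ _).symm.subset
    refine ⟨n + m + 1, hsub (by simpa using mul_mem_mul hn (hA1 m)), ?_⟩
    filter_upwards [hev] with j hj
    refine hsub ?_
    simpa using mul_mem_mul hn (show x⁻¹ * u j ∈ A m from
      Or.inr (Or.inl (subset_accumulate hj)))
  refine ⟨H, fun n => A n ^ n, ?_, fun n => subset_iUnion (fun n => A n ^ n) n,
    fun n => (hAc n).pow n, hcap⟩
  rw [← isClosed_compl_iff]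
  refine IsSeqClosed.isClosed fun u x hu hux hx => ?_
  obtain ⟨n, -, hev⟩ := hcap u x hx hux
  obtain ⟨j, hj⟩ := hev.exists
  exact hu j (mem_iUnion.2 ⟨n, hj⟩)

end OpenSubgroup

theorem theorem1 (G : Type u) [TopologicalSpace G] [Group G] [IsTopologicalGroup G] [T1Space G]
    [SequentialSpace G] (hG : csStarCharacter G ≤ Cardinal.aleph0) :
    IsMOmegaGroup G ∧
      (TopologicalSpace.MetrizableSpace G ∨
        ∃ H : Subgroup G, IsOpen (H : Set G) ∧ IsMKOmegaGroup H ∧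
          ∃ (D : Type u) (_ : TopologicalSpace D) (_ : DiscreteTopology D),
            Nonempty (G ≃ₜ H × D)) := by
  obtain ⟨N, hNc, hN⟩ := exists_countable_isCsStarNetworkAt hG (1 : G)
  obtain ⟨M, hMc, hM, hMcl, hMu⟩ := exists_countable_isCsNetworkAtOne hNc hN
  by_cases hb : HasBarriersAtOne M
  · have hmet := hb.metrizableSpace hMc
    refine ⟨⟨inferInstance, {univ}, countable_singleton _, ?_, ?_⟩, Or.inl hmet⟩
    · refine hasInductiveTopology_of_seq ?_ fun u x _ => ⟨univ, rfl, mem_univ x, by simp⟩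
      rintro _ rfl
      exact isClosed_univ
    · rintro _ rfl
      exact ⟨isClosed_univ, inferInstance⟩
  obtain ⟨x, hx⟩ := exists_isFan hM hMc hMu hb
  obtain ⟨H, C, hHo, hCH, hC, hcap⟩ := exists_open_subgroup_of_isSeqCompact
    (K := {A | A ∈ sInter '' {t : Set (Set G) | t.Finite ∧ t ⊆ M} ∧ IsSeqCompact A})
    (((countable_ofPred_finite_subset hMc).image _).mono fun A hA => hA.1) (fun A hA => hA.2)
    fun s hs => by
      obtain ⟨t, htf, htM, htc, hst⟩ := hx.exists_isSeqCompact_sInter hM hMc hMcl hs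
      exact ⟨_, ⟨⟨t, ⟨htf, htM⟩, rfl⟩, htc⟩, hst⟩
  have hCm := fun n => (hC n).isCompact_and_metrizableSpace hM hMc hMu
  have hHc : IsClosed (H : Set G) := H.isClosed_of_isOpen hHo
  have hseq : SequentialSpace H := hHc.sequentialSpace
  let E : ℕ → Set H := fun n => Subtype.val ⁻¹' C n
  have hE : ∀ n, IsCompact (E n) := fun n =>
    hHc.isClosedEmbedding_subtypeVal.isCompact_preimage (hCm n).1
  have hEm : ∀ n, TopologicalSpace.MetrizableSpace (E n) := by
    intro n
    have := (hCm n).2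
    have hemb : IsEmbedding fun y : E n => (⟨y.1.1, y.2⟩ : C n) :=
      IsEmbedding.of_comp (g := (Subtype.val : C n → G)) (by fun_prop) continuous_subtype_val
        ((IsEmbedding.subtypeVal (p := (· ∈ H))).comp IsEmbedding.subtypeVal)
    exact hemb.metrizableSpace
  have hEcap : ∀ (u : ℕ → H) (y : H), Tendsto u atTop (𝓝 y) →
      ∃ n, y ∈ E n ∧ ∀ᶠ j in atTop, u j ∈ E n := fun u y huy =>
    hcap _ y y.2 (tendsto_subtype_rng.1 huy)
  let e := H.homeomorphProdQuotient hHo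
  have hD : DiscreteTopology (G ⧸ H) := QuotientGroup.discreteTopology hHo
  refine ⟨⟨inferInstance, range fun n => {g | (e g).1 ∈ E n}, countable_range _, ?_, ?_⟩,
    Or.inr ⟨H, hHo, ⟨inferInstance, range E, countable_range _, ?_, ?_⟩,
      G ⧸ H, inferInstance, hD, ⟨e⟩⟩⟩
  · refine hasInductiveTopology_of_seq ?_ fun u g hug => ?_
    · rintro _ ⟨n, rfl⟩
      exact (hE n).isClosed.preimage (continuous_fst.comp e.continuous)
    · obtain ⟨n, hn, hev⟩ := hEcap _ _ (((continuous_fst.comp e.continuous).tendsto g).comp hug)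
      exact ⟨_, ⟨n, rfl⟩, hn, hev⟩
  · rintro _ ⟨n, rfl⟩
    refine ⟨(hE n).isClosed.preimage (continuous_fst.comp e.continuous), ?_⟩
    have := hEm n
    have hemb : IsEmbedding fun g : {g | (e g).1 ∈ E n} =>
        ((⟨(e g.1).1, g.2⟩, (e g.1).2) : E n × (G ⧸ H)) :=
      IsEmbedding.of_comp (by fun_prop)
        (continuous_subtype_val.prodMap continuous_id)
        (e.isEmbedding.comp IsEmbedding.subtypeVal)
    exact hemb.metrizableSpace
  · refine hasInductiveTopology_of_seq ?_ fun u y huy => ?_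
    · rintro _ ⟨n, rfl⟩
      exact (hE n).isClosed
    · obtain ⟨n, hn, hev⟩ := hEcap u y huy
      exact ⟨_, ⟨n, rfl⟩, hn, hev⟩
  · rintro _ ⟨n, rfl⟩
    exact ⟨(hE n).isClosed, hE n, hEm n⟩
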